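/- A set system is a pair $D=(E,\mathcal F)$ with $E$ a finite set and $\mathcal F$ a collection of subsets of $E$, called feasible sets. It is a delta-matroid if $\mathcal F\neq\emptyset$ and for all $X,Y\in\mathcal F$ and $u\in X\Delta Y$ there is $v\in X\Delta Y$ (possibly $v=u$) with $X\Delta\{u,v\}\in\mathcal F$; it is normal if $\emptyset\in\mathcal F$. For $A\subseteq E$, the twist is $D*A=(E,\{A\Delta X: X\in\mathcal F\})$. The width $w(D)$ is the difference between the maximum and the minimum cardinality of a feasible set, and the twist polynomial is ${}^{\partial}w_D(z)=\sum_{A\subseteq E}z^{w(D*A)}$. For a symmetric matrix $C$ over $GF(2)$ with rows and columns indexed by $E$, let $D(C)$ be the set system on $E$ whose feasible sets are the $A\subseteq E$ for which the principal submatrix $C[A]$ is non-singular ($C[\emptyset]$ is non-singular by convention). A delta-matroid is binary if some twist of it is isomorphic to $D(C)$ for some symmetric matrix $C$ over $GF(2)$. If $D$ is a normal binary delta-matroid, then $D=D(C)$ for a unique symmetric matrix $C$ over $GF(2)$ indexed by $E$, which is given by: $C_{v,v}=1$ if and only if $\{v\}\in\mathcal F$; and, for $u\ne v$, $C_{u,v}=1$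 if and only if either $\{u\},\{v\}\in\mathcal F$ and $\{u,v\}\notin\mathcal F$, or $\{u,v\}\in\mathcal F$ and $\{u\},\{v\}$ are not both in $\mathcal F$. The intersection graph $G_D$ has vertex set $E$; distinct vertices $u,v$ are adjacent if and only if $C_{u,v}=1$, and there is a loop at $v$ if and only if $C_{v,v}=1$. **Main Theorem.** Let $D=(E,\mathcal F)$ be a normal binary delta-matroid. Then ${}^{\partial}w_D(z)=mz^k$ for some integers $m$ and $k\ge 0$ if and only if each connected component of $G_D$ is either a complete graph (without loops) of odd order or a single vertex with a loop. -/

import Mathlib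

open scoped symmDiff

/-- A set system whose ground set is the (finite) type `E`: a collection of feasible subsets. -/
structure SetSystem (E : Type*) where
  /-- The collection of feasible sets. -/
  feasible : Set (Finset E)

namespace SetSystem

variable {E E' : Type*}

/-- Proper set systems satisfying the symmetric exchange axiom. -/
structure IsDeltaMatroid [DecidableEq E] (D : SetSystem E) : Prop where
  proper : D.feasible.Nonempty
  exchange : ∀ X ∈ D.feasible, ∀ Y ∈ D.feasible, ∀ u ∈ X ∆ Y,
    ∃ v ∈ X ∆ Y, X ∆ {u, v} ∈ D.feasible

/-- A set system is normal if the empty set is feasible. -/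
def IsNormal (D : SetSystem E) : Prop := ∅ ∈ D.feasible

/-- The twist `D * A`, whose feasible sets are the `A ∆ X` with `X` feasible. -/
def twist [DecidableEq E] (D : SetSystem E) (A : Finset E) : SetSystem E where
  feasible := {Y | ∃ X ∈ D.feasible, Y = A ∆ X}

/-- The common cardinality of the feasible sets of maximum cardinality, i.e. the rank of the
upper matroid. -/
noncomputable def upperRank (D : SetSystem E) : ℕ := sSup (Finset.card '' D.feasible)

/-- The common cardinality of the feasible sets of minimum cardinality, i.e. the rank of the
lower matroid. -/
noncomputable def lowerRank (D : SetSystem E) : ℕ := sInf (Finset.card '' D.feasible)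

/-- The width. On a finite ground set, and for a proper set system, the subtraction does not
truncate. -/
noncomputable def width (D : SetSystem E) : ℕ := D.upperRank - D.lowerRank

/-- The twist polynomial `∑_{A ⊆ E} z ^ w(D * A)`. -/
noncomputable def twistPolynomial [Fintype E] [DecidableEq E] (D : SetSystem E) :
    Polynomial ℤ :=
  ∑ A : Finset E, Polynomial.X ^ (D.twist A).width

/-- Isomorphism of set systems: a bijection of the ground sets matching the feasible sets. -/
def IsIsomorphic (D : SetSystem E) (D' : SetSystem E') : Prop :=
  ∃ e : E ≃ E', ∀ X : Finset E, X ∈ D.feasible ↔ X.map e.toEmbedding ∈ D'.feasible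

/-- The set system `D(C)`: a set `A` is feasible if the principal submatrix `C[A]` is non-singular
(the `0 × 0` determinant is `1`, so the empty set is feasible). -/
def ofMatrix [DecidableEq E] (C : Matrix E E (ZMod 2)) : SetSystem E where
  feasible := {A | (C.submatrix (Subtype.val : A → E) (Subtype.val : A → E)).det ≠ 0}

/-- Some twist is isomorphic to `D(C)` for a symmetric matrix `C` over `GF(2)`. The index set of
`C` is a finite set, which up to isomorphism is `Fin n`. -/
def IsBinary [DecidableEq E] (D : SetSystem E) : Prop :=
  ∃ (A : Finset E) (n : ℕ) (C : Matrix (Fin n) (Fin n) (ZMod 2)),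
    C.IsSymm ∧ (D.twist A).IsIsomorphic (ofMatrix C)

open Classical in
/-- The matrix over `GF(2)` read off from the feasible sets of size one and two. For a normal
binary delta-matroid it is the unique symmetric matrix `C` with `D = D(C)`; see
`intersectionMatrix_ofMatrix`. -/
noncomputable def intersectionMatrix [DecidableEq E] (D : SetSystem E) : Matrix E E (ZMod 2) :=
  fun u v =>
    if u = v then (if {v} ∈ D.feasible then 1 else 0)
    else if ({u} ∈ D.feasible ∧ {v} ∈ D.feasible ∧ {u, v} ∉ D.feasible) ∨
        ({u, v} ∈ D.feasible ∧ ¬ ({u} ∈ D.feasible ∧ {v} ∈ D.feasible)) then 1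
    else 0

end SetSystem

/-- An undirected graph without multiple edges in which loops are allowed; there is a loop at `v`
when `Adj v v`. -/
structure LoopGraph (V : Type*) where
  /-- The adjacency relation. -/
  Adj : V → V → Prop
  symm : ∀ u v, Adj u v → Adj v u

namespace LoopGraph

variable {V : Type*}

/-- The simple graph obtained by discarding all loops; it has the same connected components. -/
def toSimpleGraph (G : LoopGraph V) : SimpleGraph V where
  Adj u v := u ≠ v ∧ G.Adj u v
  symm := ⟨fun _ _ h => ⟨h.1.symm, G.symm _ _ h.2⟩⟩
  loopless := ⟨fun _ h => h.1 rfl⟩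

/-- The subgraph induced on `S` is a (loopless) complete graph of odd order: two vertices of `S`
are adjacent exactly if they are distinct. -/
def IsOddCompleteOn (G : LoopGraph V) (S : Set V) : Prop :=
  Odd S.ncard ∧ ∀ u ∈ S, ∀ v ∈ S, (G.Adj u v ↔ u ≠ v)

/-- The subgraph induced on `S` is a single vertex with a loop. -/
def IsLoopedVertexOn (G : LoopGraph V) (S : Set V) : Prop :=
  ∃ v, S = {v} ∧ G.Adj v v

end LoopGraph

namespace SetSystem

variable {E : Type*}

theorem intersectionMatrix_symm [DecidableEq E] (D : SetSystem E) (u v : E) :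
    D.intersectionMatrix u v = D.intersectionMatrix v u := by
  by_cases h : u = v
  · rw [h]
  · have h' : v ≠ u := fun e => h e.symm
    have hp : ({v, u} : Finset E) = {u, v} := Finset.pair_comm v u
    simp only [intersectionMatrix, if_neg h, if_neg h']
    congr 1
    apply propext
    rw [hp]
    tauto

/-- The intersection graph: `u` and `v` are adjacent when `C u v = 1`, and there is a loop at `v`
when `C v v = 1`, where `C` is the matrix of `D`. -/
noncomputable def intersectionGraph [DecidableEq E] (D : SetSystem E) : LoopGraph E where
  Adj u v := D.intersectionMatrix u v = 1
  symm u v h := by rw [intersectionMatrix_symm]; exact h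

theorem singleton_mem_ofMatrix [DecidableEq E] (C : Matrix E E (ZMod 2)) (v : E) :
    {v} ∈ (ofMatrix C).feasible ↔ C v v ≠ 0 := by
  have : Unique ({v} : Finset E) := ⟨⟨⟨v, by simp⟩⟩, fun x => Subtype.ext (Finset.mem_singleton.1 x.2)⟩
  have hd : ((default : ({v} : Finset E)) : E) = v :=
    Finset.mem_singleton.1 (default : ({v} : Finset E)).2
  simp only [ofMatrix, Set.mem_ofPred_eq]
  rw [Matrix.det_unique, Matrix.submatrix_apply, hd]

theorem pair_mem_ofMatrix [DecidableEq E] (C : Matrix E E (ZMod 2)) {u v : E} (h : u ≠ v) :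
    {u, v} ∈ (ofMatrix C).feasible ↔ C u u * C v v - C u v * C v u ≠ 0 := by
  let f : Fin 2 → ({u, v} : Finset E) := ![⟨u, by simp⟩, ⟨v, by simp⟩]
  have hf : Function.Bijective f := by
    constructor
    · intro i j hij
      fin_cases i <;> fin_cases j <;> simp_all [f]
    · rintro ⟨x, hx⟩
      rcases Finset.mem_insert.1 hx with rfl | hx'
      · exact ⟨0, rfl⟩
      · obtain rfl := Finset.mem_singleton.1 hx'
        exact ⟨1, rfl⟩
  simp only [ofMatrix, Set.mem_ofPred_eq]
  rw [← Matrix.det_submatrix_equiv_self (Equiv.ofBijective f hf), Matrix.det_fin_two]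
  simp [f]

/-- The matrix read off from `D(C)` is `C`. -/
theorem intersectionMatrix_ofMatrix [DecidableEq E] (C : Matrix E E (ZMod 2)) (hC : C.IsSymm) :
    (ofMatrix C).intersectionMatrix = C := by
  have key : ∀ a b c : ZMod 2,
      ((a ≠ 0 ∧ b ≠ 0 ∧ ¬ (a * b - c * c ≠ 0)) ∨ (a * b - c * c ≠ 0 ∧ ¬ (a ≠ 0 ∧ b ≠ 0))) ↔
        c = 1 := by decide
  have z : ∀ a : ZMod 2, a ≠ 1 → 0 = a := by decide
  have z' : ∀ a : ZMod 2, a ≠ 0 → 1 = a := by decide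
  ext u v
  by_cases h : u = v
  · subst h
    simp only [intersectionMatrix, if_true, singleton_mem_ofMatrix]
    split_ifs with h1
    · exact z' _ h1
    · exact (not_not.1 h1).symm
  · have hs : C v u = C u v := hC.apply u v
    have hk := key (C u u) (C v v) (C u v)
    have hp := pair_mem_ofMatrix C h
    rw [hs] at hp
    have hu := singleton_mem_ofMatrix C u
    have hv := singleton_mem_ofMatrix C v
    simp only [intersectionMatrix, if_neg h, hp, hu, hv, hk]
    split_ifs with h1
    · exact h1.symm
    · exact z _ h1

end SetSystem

/-! By a principal pivot, normality gives D = D(C) with C symmetric. Write n(A) for the nullity of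
C[A]. The distance |A Δ X| from A to a nearest feasible X is n(A) (`nullity_le_card_symmDiff`,
`exists_card_symmDiff_eq_nullity`). Since |A Δ X| + |Aᶜ Δ X| = |E|, the width of D * A is |E| − n(A)
− n(Aᶜ). The powers of z cannot cancel, so the twist polynomial is a monomial exactly when n(A) +
n(Aᶜ) = n(E) for every A.

Necessity needs this splitting only for |A| ≤ 2. Kernel vectors of C vanish at every loop, and each
loopless vertex has a kernel vector that is nonzero there. Distinct loopless u, v are adjacent
exactly when x_u = x_v for every kernel vector x (`ker_apply_eq_of_adj`, `adj_of_ker_apply_eq`). So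
loops are isolated and adjacency is transitive: the other components are cliques. Reading Cx = 0 at
v with x_v = 1 shows that v has even degree, so its clique is odd.

Sufficiency: for a disjoint union of cliques and isolated loops, n(A) counts the loopless cliques
that meet A in an odd number of vertices (`nullity_eq_card_oddClasses`). A clique of odd order does
so for exactly one of A, Aᶜ. -/

set_option linter.unusedSectionVars false

namespace SetSystem

open Matrix

/-! ### Kernels of principal submatrices -/

variable {E : Type*} [Fintype E] [DecidableEq E]

/-- The vectors supported on `A` that are in the kernel of the principal submatrix `C[A]`. -/
def kerOn (C : Matrix E E (ZMod 2)) (A : Finset E) : Submodule (ZMod 2) (E → ZMod 2) where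
  carrier := {w | (∀ i ∉ A, w i = 0) ∧ ∀ i ∈ A, (C *ᵥ w) i = 0}
  add_mem' := by
    rintro a b ⟨ha, ha'⟩ ⟨hb, hb'⟩
    refine ⟨fun i hi => by simp [ha i hi, hb i hi], fun i hi => ?_⟩
    simp [Matrix.mulVec_add, ha' i hi, hb' i hi]
  zero_mem' := by simp
  smul_mem' := by
    rintro c a ⟨ha, ha'⟩
    refine ⟨fun i hi => by simp [ha i hi], fun i hi => ?_⟩
    simp [Matrix.mulVec_smul, ha' i hi]

theorem mem_kerOn {C : Matrix E E (ZMod 2)} {A : Finset E} {w : E → ZMod 2} :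
    w ∈ kerOn C A ↔ (∀ i ∉ A, w i = 0) ∧ ∀ i ∈ A, (C *ᵥ w) i = 0 := Iff.rfl

/-- The nullity of the principal submatrix `C[A]`. -/
noncomputable def nullity (C : Matrix E E (ZMod 2)) (A : Finset E) : ℕ :=
  Module.finrank (ZMod 2) (kerOn C A)

theorem ext_feasible {D D' : SetSystem E} (h : ∀ X, X ∈ D.feasible ↔ X ∈ D'.feasible) :
    D = D' := by
  cases D; cases D'; congr 1; exact Set.ext h

theorem zmod_two_eq_one {a : ZMod 2} (h : a ≠ 0) : a = 1 := by
  revert a; decide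

theorem mulVec_eq_submatrix_mulVec (C : Matrix E E (ZMod 2)) {A : Finset E} {w : E → ZMod 2}
    (hw : ∀ i ∉ A, w i = 0) (i : A) :
    (C *ᵥ w) i = (C.submatrix (Subtype.val : A → E) Subtype.val *ᵥ fun j : A => w j) i := by
  simp only [Matrix.mulVec, dotProduct, Matrix.submatrix_apply]
  rw [Finset.sum_coe_sort A (fun j => C i j * w j)]
  exact (Finset.sum_subset (Finset.subset_univ A) fun j _ hj => by simp [hw j hj]).symm

theorem mem_ofMatrix_iff {C : Matrix E E (ZMod 2)} {A : Finset E} :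
    A ∈ (ofMatrix C).feasible ↔ ∀ w ∈ kerOn C A, w = 0 := by
  simp only [ofMatrix, Set.mem_ofPred_eq]
  rw [← not_iff_not, not_not, ← Matrix.exists_mulVec_eq_zero_iff]
  push Not
  constructor
  · rintro ⟨v, hv, h⟩
    have hw : ∀ i ∉ A, (fun i => if h : i ∈ A then v ⟨i, h⟩ else 0 : E → ZMod 2) i = 0 :=
      fun i hi => by simp [hi]
    have hres : (fun j : A => (fun i => if h : i ∈ A then v ⟨i, h⟩ else 0 : E → ZMod 2) j) = v := by
      ext j; simp
    refine ⟨_, ⟨hw, fun i hi => ?_⟩, fun h0 => hv ?_⟩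
    · rw [mulVec_eq_submatrix_mulVec C hw ⟨i, hi⟩, hres, h]; rfl
    · rw [← hres, h0]; rfl
  · rintro ⟨w, ⟨hw, hw'⟩, h0⟩
    refine ⟨fun j : A => w j, fun h => h0 ?_, ?_⟩
    · ext i
      by_cases hi : i ∈ A
      · exact congrFun h ⟨i, hi⟩
      · exact hw i hi
    · ext i
      rw [← mulVec_eq_submatrix_mulVec C hw i]
      exact hw' i i.2

/-! ### Principal pivoting and the reduction to D(C) -/

theorem dotProduct_mulVec_symm {C : Matrix E E (ZMod 2)} (hC : C.IsSymm) (x y : E → ZMod 2) :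
    x ⬝ᵥ (C *ᵥ y) = y ⬝ᵥ (C *ᵥ x) := by
  rw [Matrix.dotProduct_mulVec, ← Matrix.mulVec_transpose, hC.eq, dotProduct_comm]

theorem mem_twist_iff {D : SetSystem E} {A X : Finset E} :
    X ∈ (D.twist A).feasible ↔ A ∆ X ∈ D.feasible := by
  constructor
  · rintro ⟨Y, hY, rfl⟩
    rwa [symmDiff_symmDiff_cancel_left]
  · intro h
    exact ⟨_, h, (symmDiff_symmDiff_cancel_left A X).symm⟩

/-- The linear map with the coordinates of `f` on `A` and those of `g` off `A`. -/
def mixOn (A : Finset E) (f g : (E → ZMod 2) →ₗ[ZMod 2] (E → ZMod 2)) :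
    (E → ZMod 2) →ₗ[ZMod 2] (E → ZMod 2) where
  toFun w i := if i ∈ A then f w i else g w i
  map_add' a b := by ext i; by_cases h : i ∈ A <;> simp [h]
  map_smul' c a := by ext i; by_cases h : i ∈ A <;> simp [h]

theorem mixOn_apply (A : Finset E) (f g : (E → ZMod 2) →ₗ[ZMod 2] (E → ZMod 2))
    (w : E → ZMod 2) (i : E) : mixOn A f g w i = if i ∈ A then f w i else g w i := rfl

/-- Twisting `D(C)` by a feasible set gives the set system of another symmetric matrix
(the principal pivot transform of `C`). -/
theorem exists_ofMatrix_eq_twist {C : Matrix E E (ZMod 2)} (hC : C.IsSymm) {A : Finset E}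
    (hA : A ∈ (ofMatrix C).feasible) :
    ∃ C' : Matrix E E (ZMod 2), C'.IsSymm ∧ (ofMatrix C).twist A = ofMatrix C' := by
  set φ := mixOn A C.mulVecLin LinearMap.id with hφ
  set χ := mixOn A LinearMap.id C.mulVecLin with hχ
  have hinj : Function.Injective φ := by
    rw [injective_iff_map_eq_zero]
    intro w hw
    refine mem_ofMatrix_iff.1 hA w ⟨fun i hi => ?_, fun i hi => ?_⟩
    · simpa [hφ, mixOn_apply, hi] using congrFun hw i
    · simpa [hφ, mixOn_apply, hi] using congrFun hw i
  let e := LinearEquiv.ofInjectiveEndo φ hinj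
  have he : ∀ w, φ (e.symm w) = w := fun w => e.apply_symm_apply w
  -- The pair (φ a, χ a) is (a, C a) with its two entries exchanged at each coordinate in A. In
  -- characteristic 2 such exchanges preserve the form a·b' + b·a', so the symmetry of C passes to χ
  -- ∘ φ⁻¹.
  have hiso : ∀ a b, φ a ⬝ᵥ χ b = φ b ⬝ᵥ χ a := by
    intro a b
    have h2 : ∀ p q r s : ZMod 2, p = q → r + p = s + q → r = s := by
      rintro p q r s rfl h; exact add_right_cancel h
    have key : φ a ⬝ᵥ χ b + (a ⬝ᵥ (C *ᵥ b)) = φ b ⬝ᵥ χ a + (b ⬝ᵥ (C *ᵥ a)) := by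
      simp only [dotProduct, ← Finset.sum_add_distrib]
      refine Finset.sum_congr rfl fun i _ => ?_
      have h3 : ∀ p q : ZMod 2, p + p = q + q := by decide
      by_cases hi : i ∈ A
      · simp only [hφ, hχ, mixOn_apply, hi, if_true, LinearMap.id_apply, Matrix.mulVecLin_apply]
        ring
      · simp only [hφ, hχ, mixOn_apply, hi, if_false, LinearMap.id_apply, Matrix.mulVecLin_apply]
        exact h3 _ _
    exact h2 _ _ _ _ (dotProduct_mulVec_symm hC a b) key
  let f : (E → ZMod 2) →ₗ[ZMod 2] (E → ZMod 2) := χ ∘ₗ e.symm.toLinearMap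
  have hf : ∀ w, LinearMap.toMatrix' f *ᵥ w = χ (e.symm w) := fun w => by
    rw [LinearMap.toMatrix'_mulVec]; rfl
  refine ⟨LinearMap.toMatrix' f, ?_, ?_⟩
  · ext i j
    have h := hiso (e.symm (Pi.single i 1)) (e.symm (Pi.single j 1))
    rw [he, he, ← hf, ← hf] at h
    simpa using h.symm
  · refine ext_feasible fun X => ?_
    rw [mem_twist_iff, mem_ofMatrix_iff, mem_ofMatrix_iff]
    -- Coordinatewise, φ w = 0 off X and χ w = 0 on X say that C w = 0 on A ∆ X and w = 0 elsewhere.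
    have hmem : ∀ w, φ w ∈ kerOn (LinearMap.toMatrix' f) X ↔ w ∈ kerOn C (A ∆ X) := by
      intro w
      have hw : e.symm (φ w) = w := e.symm_apply_apply w
      rw [mem_kerOn, mem_kerOn, hf, hw, ← forall_and, ← forall_and]
      refine forall_congr' fun i => ?_
      by_cases hi : i ∈ A <;> by_cases hX : i ∈ X <;>
        simp [hφ, hχ, mixOn_apply, hi, hX, Finset.mem_symmDiff]
    constructor
    · intro h w hw
      have := h (e.symm w) ((hmem _).1 (by rwa [he]))
      rw [← he w, this, map_zero]
    · intro h w hw
      exact hinj (by rw [h _ ((hmem w).2 hw), map_zero])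

/-- Since ∅ is feasible in D, the set A is feasible in D * A, so the twist by A can be undone by a
pivot. -/
theorem exists_eq_ofMatrix {D : SetSystem E} (hnormal : D.IsNormal) (hbinary : D.IsBinary) :
    ∃ C : Matrix E E (ZMod 2), C.IsSymm ∧ D = ofMatrix C := by
  obtain ⟨A, n, C₀, hC₀, e, he⟩ := hbinary
  have htw : D.twist A = ofMatrix (C₀.submatrix e e) := by
    refine ext_feasible fun X => ?_
    refine (he X).trans ?_
    simp only [ofMatrix, Set.mem_ofPred_eq]
    let g : X ≃ X.map e.toEmbedding :=
      e.subtypeEquiv fun a => by simp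
    rw [← Matrix.det_submatrix_equiv_self g]
    rfl
  have hsymm : (C₀.submatrix e e).IsSymm := hC₀.submatrix e
  have hA : A ∈ (ofMatrix (C₀.submatrix e e)).feasible := by
    rw [← htw, mem_twist_iff, symmDiff_self]
    exact hnormal
  obtain ⟨C, hC, h⟩ := exists_ofMatrix_eq_twist hsymm hA
  refine ⟨C, hC, ?_⟩
  rw [← h, ← htw]
  refine ext_feasible fun X => ?_
  rw [mem_twist_iff, mem_twist_iff, symmDiff_symmDiff_cancel_left]

/-! ### Widths of twists in terms of nullities -/

/-- A vector w in the kernel of C[A] is determined by w on A \ X together with C w on X \ A: if both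
vanish, w lies in the kernel of C[X], which is zero. -/
theorem nullity_le_card_symmDiff (C : Matrix E E (ZMod 2)) (A : Finset E) {X : Finset E}
    (hX : X ∈ (ofMatrix C).feasible) : nullity C A ≤ (A ∆ X).card := by
  let g := (LinearMap.funLeft (ZMod 2) (ZMod 2) (Subtype.val : ↥(A ∆ X) → E)) ∘ₗ
    mixOn A LinearMap.id C.mulVecLin ∘ₗ (kerOn C A).subtype
  have hg : Function.Injective g := by
    rw [injective_iff_map_eq_zero]
    rintro ⟨w, hw, hw'⟩ h
    have h0 : ∀ i ∈ A ∆ X, (if i ∈ A then w i else (C *ᵥ w) i) = 0 := fun i hi =>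
      congrFun h ⟨i, hi⟩
    have : w = 0 := by
      refine mem_ofMatrix_iff.1 hX w ⟨fun i hi => ?_, fun i hi => ?_⟩
      · by_cases hA : i ∈ A
        · simpa [hA] using h0 i (by simp [Finset.mem_symmDiff, hA, hi])
        · exact hw i hA
      · by_cases hA : i ∈ A
        · exact hw' i hA
        · simpa [hA] using h0 i (by simp [Finset.mem_symmDiff, hA, hi])
    exact Subtype.ext this
  simpa [nullity] using LinearMap.finrank_le_finrank_of_injective hg

theorem exists_card_symmDiff_eq_nullity {C : Matrix E E (ZMod 2)} (hC : C.IsSymm)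
    (A : Finset E) : ∃ X ∈ (ofMatrix C).feasible, (A ∆ X).card = nullity C A := by
  -- Y is a minimal set of coordinates in A that determines the vectors of ker C[A]. Minimality
  -- yields a dual basis of the kernel indexed by Y, and A \ Y is the feasible set sought.
  obtain ⟨Y, hYA, hY⟩ := exists_minimal_le_of_wellFoundedLT
    (fun Y : Finset E => Y ⊆ A ∧ ∀ w ∈ kerOn C A, (∀ i ∈ Y, w i = 0) → w = 0) A
    ⟨subset_rfl, fun w hw h => by
      ext i
      by_cases hi : i ∈ A
      · exact h i hi
      · exact hw.1 i hi⟩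
  have hinj := hY.prop.2
  have hex : ∀ y ∈ Y, ∃ k ∈ kerOn C A, ∀ i ∈ Y, k i = if i = y then 1 else 0 := by
    intro y hy
    by_contra! hcon
    have hlt : ¬ Y ⊆ Y.erase y := fun h => Finset.notMem_erase y Y (h hy)
    refine hlt (hY.le_of_le ⟨(Finset.erase_subset _ _).trans hYA, fun w hw h => ?_⟩
      (Finset.erase_subset _ _))
    by_contra hw0
    obtain ⟨i, hi, hne⟩ := hcon w hw
    by_cases hiy : i = y
    · subst hiy
      refine hw0 (hinj w hw fun j hj => ?_)
      by_cases hji : j = i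
      · subst hji
        by_contra h1
        exact hne (by simpa using zmod_two_eq_one h1)
      · exact h j (Finset.mem_erase.2 ⟨hji, hj⟩)
    · exact hne (by simpa [hiy] using h i (Finset.mem_erase.2 ⟨hiy, hi⟩))
  refine ⟨A \ Y, ?_, ?_⟩
  · rw [mem_ofMatrix_iff]
    rintro w ⟨hw, hw'⟩
    refine hinj w ⟨fun i hi => hw i (by simp [hi]), fun i hi => ?_⟩ fun i hi => hw i (by simp [hi])
    by_cases hiY : i ∈ Y
    · obtain ⟨k, ⟨hk, hk'⟩, hki⟩ := hex i hiY
      -- By symmetry k · C w = 0 as well. Only the term at i survives, so (C w)_i = 0; thus w lies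
      -- in ker C[A] and vanishes on Y.
      have h1 : w ⬝ᵥ (C *ᵥ k) = 0 := Finset.sum_eq_zero fun j _ => by
        by_cases hj : j ∈ A
        · simp [hk' j hj]
        · simp [hw j (by simp [hj])]
      rw [dotProduct_mulVec_symm hC, dotProduct, Finset.sum_eq_single i] at h1
      · simpa [hki i hiY] using h1
      · intro j _ hji
        by_cases hjA : j ∈ A
        · by_cases hjY : j ∈ Y
          · simp [hki j hjY, hji]
          · simp [hw' j (by simp [hjA, hjY])]
        · simp [hk j hjA]
      · simp
    · exact hw' i (by simp [hi, hiY])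
  · have hsd : A ∆ (A \ Y) = Y := by
      ext i
      have := @hYA i
      simp only [Finset.mem_symmDiff, Finset.mem_sdiff]
      tauto
    rw [hsd]
    let g := (LinearMap.funLeft (ZMod 2) (ZMod 2) (Subtype.val : Y → E)) ∘ₗ (kerOn C A).subtype
    have hg : Function.Injective g := by
      rw [injective_iff_map_eq_zero]
      rintro ⟨w, hw⟩ h
      exact Subtype.ext (hinj w hw fun i hi => congrFun h ⟨i, hi⟩)
    have hs : Function.Surjective g := by
      rw [← LinearMap.range_eq_top, eq_top_iff, ← (Pi.basisFun (ZMod 2) Y).span_eq,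
        Submodule.span_le]
      rintro _ ⟨y, rfl⟩
      obtain ⟨k, hk, hki⟩ := hex y y.2
      refine ⟨⟨k, hk⟩, ?_⟩
      ext i
      rw [Pi.basisFun_apply, Pi.single_apply]
      refine (hki i i.2).trans ?_
      simp only [Subtype.ext_iff]
    simpa [nullity] using (LinearEquiv.ofBijective g ⟨hg, hs⟩).finrank_eq.symm

theorem lowerRank_twist_ofMatrix {C : Matrix E E (ZMod 2)} (hC : C.IsSymm) (A : Finset E) :
    ((ofMatrix C).twist A).lowerRank = nullity C A := by
  obtain ⟨X, hX, h⟩ := exists_card_symmDiff_eq_nullity hC A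
  refine IsLeast.csInf_eq ⟨⟨A ∆ X, ⟨X, hX, rfl⟩, h⟩, ?_⟩
  rintro _ ⟨_, ⟨Y, hY, rfl⟩, rfl⟩
  exact nullity_le_card_symmDiff C A hY

theorem card_compl_symmDiff (A X : Finset E) :
    (A ∆ X).card + (Aᶜ ∆ X).card = Fintype.card E := by
  have : Aᶜ ∆ X = (A ∆ X)ᶜ := by
    ext i
    simp only [Finset.mem_symmDiff, Finset.mem_compl]
    tauto
  rw [this, Finset.card_add_card_compl]

/-- A feasible set farthest from A is one nearest to Aᶜ. -/
theorem upperRank_twist_ofMatrix {C : Matrix E E (ZMod 2)} (hC : C.IsSymm) (A : Finset E) :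
    ((ofMatrix C).twist A).upperRank = Fintype.card E - nullity C Aᶜ := by
  obtain ⟨X, hX, h⟩ := exists_card_symmDiff_eq_nullity hC Aᶜ
  refine IsGreatest.csSup_eq ⟨⟨A ∆ X, ⟨X, hX, rfl⟩, ?_⟩, ?_⟩
  · have := card_compl_symmDiff A X
    omega
  · rintro _ ⟨_, ⟨Y, hY, rfl⟩, rfl⟩
    have := card_compl_symmDiff A Y
    have := nullity_le_card_symmDiff C Aᶜ hY
    omega

theorem nullity_le_card (C : Matrix E E (ZMod 2)) (A : Finset E) : nullity C A ≤ A.card := by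
  have h : ∅ ∈ (ofMatrix C).feasible := mem_ofMatrix_iff.2 fun w hw => by
    ext i; exact hw.1 i (by simp)
  have := nullity_le_card_symmDiff C A h
  rwa [← Finset.bot_eq_empty, symmDiff_bot] at this

/-- The width of a twist, in terms of nullities of complementary principal submatrices. -/
theorem width_twist_ofMatrix {C : Matrix E E (ZMod 2)} (hC : C.IsSymm) (A : Finset E) :
    ((ofMatrix C).twist A).width + (nullity C A + nullity C Aᶜ) = Fintype.card E := by
  rw [width, lowerRank_twist_ofMatrix hC, upperRank_twist_ofMatrix hC]
  have h1 := nullity_le_card C A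
  have h2 := nullity_le_card C Aᶜ
  have h3 := Finset.card_add_card_compl A
  omega

/-! ### Monomial twist polynomials and splitting of the nullity -/

theorem sum_X_pow_eq_monomial_iff {ι : Type*} [Fintype ι] (f : ι → ℕ) (i₀ : ι) :
    (∃ (m : ℤ) (k : ℕ), ∑ i, (Polynomial.X : Polynomial ℤ) ^ f i =
      Polynomial.C m * Polynomial.X ^ k) ↔ ∀ i, f i = f i₀ := by
  constructor
  · rintro ⟨m, k, h⟩
    have hk : ∀ i, f i = k := by
      intro i
      by_contra hne
      have h1 := congrArg (fun p => p.coeff (f i)) h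
      simp only [Polynomial.finsetSum_coeff, Polynomial.coeff_X_pow,
        Polynomial.coeff_C_mul_X_pow, if_neg hne] at h1
      -- The coefficient of X ^ f i is a sum of zeros and ones in which the term of i is 1, so it
      -- cannot vanish.
      rw [Finset.sum_eq_zero_iff_of_nonneg fun j _ => by split_ifs <;> simp] at h1
      simpa using h1 i (Finset.mem_univ i)
    exact fun i => (hk i).trans (hk i₀).symm
  · intro h
    refine ⟨Fintype.card ι, f i₀, ?_⟩
    simp [h]

theorem nullity_empty (C : Matrix E E (ZMod 2)) : nullity C ∅ = 0 :=
  Nat.le_zero.1 (by simpa using nullity_le_card C ∅)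

/-- The twist polynomial of `D(C)` is a monomial if and only if the nullity of `C` splits as a sum
over every pair of complementary principal submatrices. -/
theorem twistPolynomial_monomial_iff {C : Matrix E E (ZMod 2)} (hC : C.IsSymm) :
    (∃ (m : ℤ) (k : ℕ), (ofMatrix C).twistPolynomial = Polynomial.C m * Polynomial.X ^ k) ↔
      ∀ A, nullity C A + nullity C Aᶜ = nullity C Finset.univ := by
  rw [twistPolynomial, sum_X_pow_eq_monomial_iff _ ∅]
  refine forall_congr' fun A => ?_
  have h1 := width_twist_ofMatrix hC A
  have h2 := width_twist_ofMatrix hC ∅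
  rw [nullity_empty, Finset.compl_empty] at h2
  omega

/-! ### Orthogonality and comparison of kernels -/

/-- By symmetry x · C w = w · C x = 0, and C w is supported on S. With suitable x this forces
coordinates of C w on S to vanish, which places w in ker C. -/
theorem sum_mul_mulVec_eq_zero {C : Matrix E E (ZMod 2)} (hC : C.IsSymm) {S : Finset E}
    {x w : E → ZMod 2} (hx : x ∈ kerOn C Finset.univ) (hw : w ∈ kerOn C Sᶜ) :
    ∑ i ∈ S, x i * (C *ᵥ w) i = 0 := by
  have h : x ⬝ᵥ (C *ᵥ w) = 0 := by
    rw [dotProduct_mulVec_symm hC]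
    exact Finset.sum_eq_zero fun i _ => by simp [hx.2 i (Finset.mem_univ i)]
  rw [← h]
  exact Finset.sum_subset (Finset.subset_univ S) fun i _ hi => by
    simp [hw.2 i (Finset.mem_compl.2 hi)]

theorem mem_kerOn_univ {C : Matrix E E (ZMod 2)} {w : E → ZMod 2} :
    w ∈ kerOn C Finset.univ ↔ ∀ i, (C *ᵥ w) i = 0 := by
  simp [mem_kerOn]

theorem mem_kerOn_compl_iff {C : Matrix E E (ZMod 2)} {S : Finset E} {w : E → ZMod 2} :
    w ∈ kerOn C Sᶜ ↔ (∀ i ∈ S, w i = 0) ∧ ∀ i ∉ S, (C *ᵥ w) i = 0 := by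
  simp [mem_kerOn]

theorem nullity_lt_of_lt {C : Matrix E E (ZMod 2)} {A B : Finset E}
    (h : kerOn C A < kerOn C B) : nullity C A < nullity C B :=
  Submodule.finrank_lt_finrank_of_lt h

theorem nullity_le_of_le {C : Matrix E E (ZMod 2)} {A B : Finset E}
    (h : kerOn C A ≤ kerOn C B) : nullity C A ≤ nullity C B :=
  Submodule.finrank_mono h

theorem nullity_pos {C : Matrix E E (ZMod 2)} {A : Finset E} {w : E → ZMod 2}
    (hw : w ∈ kerOn C A) (h0 : w ≠ 0) : 0 < nullity C A := by
  rw [← nullity_empty C]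
  refine nullity_lt_of_lt (lt_of_le_of_ne (fun v hv => ?_) fun h => h0 ?_)
  · rw [show v = 0 from funext fun i => hv.1 i (by simp)]
    exact Submodule.zero_mem _
  · rw [← h] at hw
    exact funext fun i => hw.1 i (by simp)

theorem nullity_eq_zero {C : Matrix E E (ZMod 2)} {A : Finset E}
    (h : A ∈ (ofMatrix C).feasible) : nullity C A = 0 := by
  simpa using nullity_le_card_symmDiff C A h

theorem nullity_compl_pair_lt {C : Matrix E E (ZMod 2)} {u v : E} {x : E → ZMod 2} (hx : x ∈ kerOn C Finset.univ)
    (hxu : x u = 1) (h : kerOn C {u, v}ᶜ ≤ kerOn C Finset.univ) :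
    nullity C {u, v}ᶜ < nullity C Finset.univ := by
  refine nullity_lt_of_lt (lt_of_le_of_ne h fun he => ?_)
  rw [← he] at hx
  have := (mem_kerOn_compl_iff.1 hx).1 u (by simp)
  simp [hxu] at this

/-! ### Consequences of splitting at sets of one or two vertices -/

section Splitting

variable {C : Matrix E E (ZMod 2)} (hC : C.IsSymm)
  (hsplit : ∀ A, nullity C A + nullity C Aᶜ = nullity C Finset.univ)

include hC hsplit

-- Here C[{v}] = 0 has positive nullity, so splitting makes the nullity off v smaller than that of
-- C; this fails if all of ker C vanishes at v.
omit hC in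
theorem exists_ker_apply_eq_one {v : E} (hv : C v v = 0) :
    ∃ x ∈ kerOn C Finset.univ, x v = 1 := by
  by_contra! hcon
  have h1 : 0 < nullity C {v} := by
    refine nullity_pos (w := Pi.single v 1) ⟨fun i hi => ?_, fun i hi => ?_⟩ ?_
    · rw [Pi.single_apply, if_neg (by simpa using hi)]
    · obtain rfl := Finset.mem_singleton.1 hi
      simpa using hv
    · simp
  have h2 : nullity C Finset.univ ≤ nullity C {v}ᶜ := by
    refine nullity_le_of_le fun w hw => mem_kerOn_compl_iff.2
      ⟨fun i hi => ?_, fun i _ => mem_kerOn_univ.1 hw i⟩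
    obtain rfl := Finset.mem_singleton.1 hi
    by_contra h
    exact hcon w hw (zmod_two_eq_one h)
  have := hsplit {v}
  omega

/-- If x_v ≠ 0, orthogonality puts the kernel off v inside ker C, properly because of x. But C[{v}]
is non-singular, so splitting makes the two nullities equal. -/
theorem ker_apply_eq_zero {v : E} (hv : C v v = 1) {x : E → ZMod 2}
    (hx : x ∈ kerOn C Finset.univ) : x v = 0 := by
  by_contra hxv
  have h1 : nullity C {v} = 0 :=
    nullity_eq_zero ((singleton_mem_ofMatrix C v).2 (by simp [hv]))
  have h2 : nullity C {v}ᶜ < nullity C Finset.univ := by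
    refine nullity_lt_of_lt (lt_of_le_of_ne (fun w hw => mem_kerOn_univ.2 fun i => ?_) fun h => ?_)
    · by_cases hi : i = v
      · subst hi
        simpa [hxv] using sum_mul_mulVec_eq_zero hC hx hw
      · exact (mem_kerOn_compl_iff.1 hw).2 i (by simpa using hi)
    · rw [← h] at hx
      exact hxv ((mem_kerOn_compl_iff.1 hx).1 v (by simp))
  have := hsplit {v}
  omega

theorem kerOn_compl_singleton_of_loop {v : E} (hv : C v v = 1) :
    kerOn C {v}ᶜ = kerOn C Finset.univ := by
  have h1 : nullity C {v} = 0 :=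
    nullity_eq_zero ((singleton_mem_ofMatrix C v).2 (by simp [hv]))
  refine (Submodule.eq_of_le_of_finrank_eq (fun w hw => mem_kerOn_compl_iff.2
    ⟨fun i hi => ?_, fun i _ => mem_kerOn_univ.1 hw i⟩) ?_).symm
  · obtain rfl := Finset.mem_singleton.1 hi
    exact ker_apply_eq_zero hC hsplit hv hw
  · have := hsplit {v}
    rw [h1, zero_add] at this
    exact this.symm

/-- Otherwise C[{u, v}] is the all-ones matrix and is singular, while ker C vanishes at u and v and
so lies in the kernel off {u, v}; the nullities then add up to too much. -/
theorem eq_zero_of_loop_of_loop {u v : E} (huv : u ≠ v) (hu : C u u = 1) (hv : C v v = 1) :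
    C u v = 0 := by
  by_contra hne
  have hone := zmod_two_eq_one hne
  have hone' : C v u = 1 := (hC.apply u v).trans hone
  have h1 : 0 < nullity C {u, v} := by
    refine nullity_pos (w := Pi.single u 1 + Pi.single v 1) ⟨fun i hi => ?_, fun i hi => ?_⟩ ?_
    · simp only [Finset.mem_insert, Finset.mem_singleton, not_or] at hi
      simp [hi.1, hi.2]
    · have h11 : (1 + 1 : ZMod 2) = 0 := by decide
      rcases Finset.mem_insert.1 hi with rfl | hi
      · simp [Matrix.mulVec_add, hu, hone, h11]
      · obtain rfl := Finset.mem_singleton.1 hi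
        simp [Matrix.mulVec_add, hv, hone', h11]
    · intro h
      simpa [huv] using congrFun h u
  have h2 : nullity C Finset.univ ≤ nullity C {u, v}ᶜ := by
    refine nullity_le_of_le fun w hw => mem_kerOn_compl_iff.2
      ⟨fun i hi => ?_, fun i _ => mem_kerOn_univ.1 hw i⟩
    rcases Finset.mem_insert.1 hi with rfl | hi
    · exact ker_apply_eq_zero hC hsplit hu hw
    · obtain rfl := Finset.mem_singleton.1 hi
      exact ker_apply_eq_zero hC hsplit hv hw
  have := hsplit {u, v}
  omega

omit hC in
theorem nullity_compl_pair_of_feasible {u v : E} (huv : u ≠ v)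
    (h : C u u * C v v - C u v * C v u ≠ 0) :
    nullity C {u, v}ᶜ = nullity C Finset.univ := by
  rw [← hsplit {u, v}, nullity_eq_zero ((pair_mem_ofMatrix C huv).2 h), zero_add]

/-- If u and v were adjacent, C[{u, v}] would be non-singular. A kernel vector with x_u = 1 and x_v
= 0 puts the kernel off {u, v} properly inside ker C, against splitting. -/
theorem eq_zero_of_loop_of_not_loop {u v : E} (hu : C u u = 0) (hv : C v v = 1) :
    C u v = 0 := by
  have huv : u ≠ v := by rintro rfl; simp [hu] at hv
  by_contra hne
  have hone := zmod_two_eq_one hne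
  have hone' : C v u = 1 := (hC.apply u v).trans hone
  obtain ⟨x, hx, hxu⟩ := exists_ker_apply_eq_one hsplit hu
  refine (nullity_compl_pair_lt hx hxu fun w hw => ?_).ne
    (nullity_compl_pair_of_feasible hsplit huv (by simp [hu, hone, hone']))
  have hsum := sum_mul_mulVec_eq_zero hC hx hw
  rw [Finset.sum_pair huv, hxu, ker_apply_eq_zero hC hsplit hv hx] at hsum
  rw [← kerOn_compl_singleton_of_loop hC hsplit hv]
  rw [mem_kerOn_compl_iff] at hw ⊢
  refine ⟨fun i hi => hw.1 i (Finset.mem_insert_of_mem hi), fun i hi => ?_⟩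
  by_cases hiu : i = u
  · subst hiu; simpa using hsum
  · exact hw.2 i (by simp_all)

/-- Kernel vectors with values (0, 1) and (1, *) at (u, v) would force C w to vanish at both
vertices for every w in the kernel off {u, v}. That kernel would be properly inside ker C, although
C[{u, v}] is non-singular. -/
theorem ker_apply_eq_of_adj {u v : E} (hu : C u u = 0) (hv : C v v = 0) (h : C u v = 1)
    {x : E → ZMod 2} (hx : x ∈ kerOn C Finset.univ) (hxu : x u = 0) : x v = 0 := by
  by_contra hxv
  have huv : u ≠ v := by rintro rfl; simp [hu] at h
  have h' : C v u = 1 := (hC.apply u v).trans h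
  obtain ⟨y, hy, hyu⟩ := exists_ker_apply_eq_one hsplit hu
  refine (nullity_compl_pair_lt hy hyu fun w hw => ?_).ne
    (nullity_compl_pair_of_feasible hsplit huv (by simp [hu, h, h']))
  have hsum := sum_mul_mulVec_eq_zero hC hx hw
  have hsum' := sum_mul_mulVec_eq_zero hC hy hw
  rw [Finset.sum_pair huv, hxu, zmod_two_eq_one hxv, zero_mul, one_mul, zero_add] at hsum
  rw [Finset.sum_pair huv, hyu, hsum, mul_zero, one_mul, add_zero] at hsum'
  rw [mem_kerOn_univ]
  intro i
  by_cases hiu : i = u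
  · rwa [hiu]
  by_cases hiv : i = v
  · rwa [hiv]
  exact (mem_kerOn_compl_iff.1 hw).2 i (by simp [hiu, hiv])

/-- If u and v were not adjacent, C[{u, v}] = 0 would have larger nullity than C[{u}], while
deleting v after u would not lower the nullity of the rest. Splitting at {u} and at {u, v} would
then disagree. -/
theorem adj_of_ker_apply_eq {u v : E} (huv : u ≠ v) (hu : C u u = 0) (hv : C v v = 0)
    (h : ∀ x ∈ kerOn C Finset.univ, x u = 0 → x v = 0) : C u v = 1 := by
  by_contra hne
  have hC0 : C u v = 0 := by
    by_contra h0; exact hne (zmod_two_eq_one h0)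
  have hC0' : C v u = 0 := (hC.apply u v).trans hC0
  obtain ⟨y, hy, hyu⟩ := exists_ker_apply_eq_one hsplit hu
  have hmem : ∀ w, (∀ i ∉ ({u, v} : Finset E), w i = 0) → w ∈ kerOn C {u, v} := by
    intro w hw
    refine ⟨hw, fun i hi => ?_⟩
    have : (C *ᵥ w) i = ∑ j ∈ ({u, v} : Finset E), C i j * w j :=
      (Finset.sum_subset (Finset.subset_univ _) fun j _ hj => by simp [hw j hj]).symm
    rw [this, Finset.sum_pair huv]
    rcases Finset.mem_insert.1 hi with rfl | hi
    · simp [hu, hC0]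
    · obtain rfl := Finset.mem_singleton.1 hi
      simp [hv, hC0']
  have h1 : nullity C {u} < nullity C {u, v} := by
    refine nullity_lt_of_lt (lt_of_le_of_ne (fun w hw => hmem w fun i hi => hw.1 i (by simp_all))
      fun he => ?_)
    have : (Pi.single v 1 : E → ZMod 2) ∈ kerOn C {u} := by
      rw [he]
      exact hmem _ fun i hi => by rw [Pi.single_apply, if_neg (by simp_all)]
    simpa using this.1 v (by simpa using huv.symm)
  have h2 : nullity C {u}ᶜ ≤ nullity C {u, v}ᶜ := by
    refine nullity_le_of_le fun w hw => ?_
    have hsum := sum_mul_mulVec_eq_zero hC hy hw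
    rw [Finset.sum_singleton, hyu, one_mul] at hsum
    have hw' := mem_kerOn_compl_iff.1 hw
    have hker : w ∈ kerOn C Finset.univ := mem_kerOn_univ.2 fun i => by
      by_cases hi : i = u
      · rwa [hi]
      · exact hw'.2 i (by simpa using hi)
    refine mem_kerOn_compl_iff.2 ⟨fun i hi => ?_, fun i _ => mem_kerOn_univ.1 hker i⟩
    have hwu := hw'.1 u (by simp)
    rcases Finset.mem_insert.1 hi with rfl | hi
    · exact hwu
    · rw [Finset.mem_singleton.1 hi]
      exact h w hker hwu
  have := hsplit {u}
  have := hsplit {u, v}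
  omega

theorem not_loop_of_adj {u v : E} (huv : u ≠ v) (h : C u v = 1) : C u u = 0 := by
  by_contra hu
  have hu := zmod_two_eq_one hu
  by_cases hv : C v v = 0
  · have h1 := eq_zero_of_loop_of_not_loop hC hsplit hv hu
    rw [hC.apply, h] at h1
    exact one_ne_zero h1
  · rw [eq_zero_of_loop_of_loop hC hsplit huv hu (zmod_two_eq_one hv)] at h
    exact zero_ne_one h

theorem adj_trans {u v t : E} (huv : u ≠ v) (hvt : v ≠ t) (hut : u ≠ t) (h : C u v = 1)
    (h' : C v t = 1) : C u t = 1 := by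
  have hu := not_loop_of_adj hC hsplit huv h
  have hv := not_loop_of_adj hC hsplit hvt h'
  have ht := not_loop_of_adj hC hsplit hvt.symm ((hC.apply v t).trans h')
  exact adj_of_ker_apply_eq hC hsplit hut hu ht fun x hx hxu =>
    ker_apply_eq_of_adj hC hsplit hv ht h' hx (ker_apply_eq_of_adj hC hsplit hu hv h hx hxu)

/-- If the nullity splits, then the number of neighbours of a loopless vertex is even. -/
theorem even_card_neighbors {v : E} (hv : C v v = 0) :
    Even (Finset.univ.filter fun u => C v u = 1).card := by
  obtain ⟨x, hx, hxv⟩ := exists_ker_apply_eq_one hsplit hv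
  have hsum := mem_kerOn_univ.1 hx v
  -- Neighbours of v are loopless, and x takes there the value x_v = 1, so (C x)_v is the degree of
  -- v modulo 2.
  have heq : (C *ᵥ x) v = ∑ u, if C v u = 1 then (1 : ZMod 2) else 0 := by
    refine Finset.sum_congr rfl fun u _ => ?_
    change C v u * x u = _
    split_ifs with h
    · have huv : u ≠ v := by rintro rfl; simp [hv] at h
      have hu := not_loop_of_adj hC hsplit huv ((hC.apply v u).trans h)
      have hxu : x u ≠ 0 := fun h0 => by
        have := ker_apply_eq_of_adj hC hsplit hu hv ((hC.apply v u).trans h) hx h0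
        simp [hxv] at this
      rw [h, zmod_two_eq_one hxu, one_mul]
    · rw [show C v u = 0 by by_contra h0; exact h (zmod_two_eq_one h0), zero_mul]
  rw [heq, Finset.sum_boole, ZMod.natCast_eq_zero_iff_even] at hsum
  exact hsum

end Splitting

/-! ### Components of the graph when the nullity splits -/

/-- The graph with adjacency `C u v = 1`. -/
def matrixGraph (C : Matrix E E (ZMod 2)) (hC : C.IsSymm) : LoopGraph E where
  Adj u v := C u v = 1
  symm u v h := (hC.apply u v).trans h

theorem components_of_nullity_split {C : Matrix E E (ZMod 2)} (hC : C.IsSymm)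
    (hsplit : ∀ A, nullity C A + nullity C Aᶜ = nullity C Finset.univ)
    (c : (matrixGraph C hC).toSimpleGraph.ConnectedComponent) :
    (matrixGraph C hC).IsOddCompleteOn c.supp ∨ (matrixGraph C hC).IsLoopedVertexOn c.supp := by
  have hreach : ∀ u v, (matrixGraph C hC).toSimpleGraph.Reachable u v → u = v ∨
      (u ≠ v ∧ C u v = 1) := by
    rintro u v ⟨p⟩
    induction p with
    | nil => exact Or.inl rfl
    | @cons a b d hab p ih =>
      obtain ⟨hne, hadj⟩ := hab
      by_cases had : a = d
      · exact Or.inl had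
      refine Or.inr ⟨had, ?_⟩
      rcases ih with rfl | ⟨hbd, h⟩
      · exact hadj
      · exact adj_trans hC hsplit hne hbd had hadj h
  induction c using SimpleGraph.ConnectedComponent.ind with
  | h v =>
  have hsupp : ∀ u, u ∈ ((matrixGraph C hC).toSimpleGraph.connectedComponentMk v).supp ↔
      (matrixGraph C hC).toSimpleGraph.Reachable u v := fun u => by
    rw [SimpleGraph.ConnectedComponent.mem_supp_iff, SimpleGraph.ConnectedComponent.eq]
  by_cases hv : C v v = 0
  · left
    have hset : ((matrixGraph C hC).toSimpleGraph.connectedComponentMk v).supp =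
        ((insert v (Finset.univ.filter fun u => C v u = 1) : Finset E) : Set E) := by
      ext u
      rw [hsupp, Finset.mem_coe, Finset.mem_insert, Finset.mem_filter]
      constructor
      · intro h
        rcases hreach u v h with h | ⟨_, h⟩
        · exact Or.inl h
        · exact Or.inr ⟨Finset.mem_univ u, (hC.apply u v).trans h⟩
      · rintro (rfl | ⟨_, h⟩)
        · rfl
        · refine SimpleGraph.Adj.reachable ⟨?_, (hC.apply v u).trans h⟩
          rintro rfl
          simp [hv] at h
    refine ⟨?_, fun u hu t ht => ⟨?_, fun hne => ?_⟩⟩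
    · rw [hset, Set.ncard_coe_finset, Finset.card_insert_of_notMem (by simp [hv])]
      exact (even_card_neighbors hC hsplit hv).add_one
    · rintro h rfl
      change C u u = 1 at h
      rcases hreach u v ((hsupp u).1 hu) with rfl | ⟨hne, h'⟩
      · simp [hv] at h
      · rw [not_loop_of_adj hC hsplit hne h'] at h
        exact zero_ne_one h
    · rcases hreach u t (((hsupp u).1 hu).trans ((hsupp t).1 ht).symm) with h | h
      · exact absurd h hne
      · exact h.2
  · right
    refine ⟨v, Set.ext fun u => ?_, zmod_two_eq_one hv⟩
    rw [hsupp, Set.mem_singleton_iff]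
    constructor
    · intro h
      rcases hreach u v h with h | ⟨hne, h⟩
      · exact h
      · exact absurd (not_loop_of_adj hC hsplit hne.symm ((hC.apply u v).trans h)) hv
    · rintro rfl; rfl

/-! ### Nullities for disjoint unions of cliques and isolated loops -/

section Cliques

variable {ι : Type*} [Fintype ι] [DecidableEq ι]

/-- The classes of `q` that carry no loop of `C` and meet `A` in an odd number of points. -/
def oddClasses (C : Matrix E E (ZMod 2)) (q : E → ι) (A : Finset E) : Finset ι :=
  Finset.univ.filter fun c => (∀ v, q v = c → C v v = 0) ∧ Odd (A.filter fun v => q v = c).card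

theorem mem_oddClasses {C : Matrix E E (ZMod 2)} {q : E → ι} {A : Finset E} {c : ι} :
    c ∈ oddClasses C q A ↔
      (∀ v, q v = c → C v v = 0) ∧ Odd (A.filter fun v => q v = c).card := by
  simp [oddClasses]

/-- The linear map summing a vector over the classes in `T`. -/
def classSum (q : E → ι) (T : Finset ι) : (E → ZMod 2) →ₗ[ZMod 2] (T → ZMod 2) where
  toFun w c := ∑ j with q j = c, w j
  map_add' a b := by ext c; simp [Finset.sum_add_distrib]
  map_smul' r a := by ext c; simp [Finset.mul_sum]

theorem sum_class_eq_card_mul {q : E → ι} {A : Finset E} {w : E → ZMod 2}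
    (hw : ∀ i ∉ A, w i = 0) {c : ι} {a : ZMod 2} (ha : ∀ i ∈ A, q i = c → w i = a) :
    ∑ j with q j = c, w j = (A.filter fun v => q v = c).card * a := by
  rw [← nsmul_eq_mul, ← Finset.sum_const]
  have hsub : A.filter (fun v => q v = c) ⊆ Finset.univ.filter fun v => q v = c :=
    Finset.filter_subset_filter _ (Finset.subset_univ A)
  rw [← Finset.sum_subset hsub]
  · refine Finset.sum_congr rfl fun i hi => ?_
    rw [Finset.mem_filter] at hi
    exact ha i hi.1 hi.2
  · intro i hi hi'
    refine hw i fun hA => hi' ?_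
    rw [Finset.mem_filter] at hi ⊢
    exact ⟨hA, hi.2⟩

variable {C : Matrix E E (ZMod 2)} {q : E → ι}
  (hadj : ∀ u v, u ≠ v → (C u v = 1 ↔ q u = q v))
  (hloop : ∀ v, C v v = 1 → ∀ u, q u = q v → u = v)

include hadj

/-- Adding the identity turns the block of a loopless clique into the all-ones matrix. The kernel
equation at i thus says that w_i equals the sum of w over its clique. -/
theorem mulVec_add_apply_of_cliques {i : E} (hi : C i i = 0) (w : E → ZMod 2) :
    (C *ᵥ w) i + w i = ∑ j with q j = q i, w j := by
  have h : ∀ j, C i j * w j + (if j = i then w j else 0) = if q j = q i then w j else 0 := by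
    intro j
    by_cases hji : j = i
    · subst hji; simp [hi]
    · by_cases hq : q j = q i
      · simp [hji, hq, (hadj i j (Ne.symm hji)).2 hq.symm]
      · have : C i j = 0 := by
          by_contra h0
          exact hq ((hadj i j (Ne.symm hji)).1 (zmod_two_eq_one h0)).symm
        simp [hji, hq, this]
  rw [Finset.sum_filter, ← Finset.sum_congr rfl fun j _ => h j, Finset.sum_add_distrib,
    Finset.sum_ite_eq' Finset.univ i w, if_pos (Finset.mem_univ i)]
  rfl

include hloop

theorem mulVec_apply_of_loop {i : E} (hi : C i i = 1) (w : E → ZMod 2) :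
    (C *ᵥ w) i = w i := by
  refine (Finset.sum_eq_single i (fun j _ hji => ?_) (by simp)).trans ?_
  · change C i j * w j = 0
    have : C i j = 0 := by
      by_contra h0
      exact hji (hloop i hi j ((hadj i j (Ne.symm hji)).1 (zmod_two_eq_one h0)).symm)
    rw [this, zero_mul]
  · change C i i * w i = w i
    rw [hi, one_mul]

theorem mem_kerOn_of_cliques {A : Finset E} {w : E → ZMod 2} :
    w ∈ kerOn C A ↔ (∀ i ∉ A, w i = 0) ∧ ∀ i ∈ A,
      (C i i = 1 → w i = 0) ∧ (C i i = 0 → w i = ∑ j with q j = q i, w j) := by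
  refine and_congr_right fun _ => forall₂_congr fun i _ => ?_
  by_cases hi : C i i = 0
  · rw [← mulVec_add_apply_of_cliques hadj hi w]
    simp [hi]
  · have hi := zmod_two_eq_one hi
    simp [hi, mulVec_apply_of_loop hadj hloop hi]

omit hadj in
theorem class_loopless {i : E} (hi : C i i = 0) : ∀ v, q v = q i → C v v = 0 := by
  intro v hv
  by_contra h0
  rw [hloop v (zmod_two_eq_one h0) i hv.symm] at hi
  exact h0 hi

/-- For a disjoint union of loopless cliques and isolated loops, the nullity of `C[A]` is the
number of cliques meeting `A` in an odd number of vertices. -/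
theorem nullity_eq_card_oddClasses (A : Finset E) :
    nullity C A = (oddClasses C q A).card := by
  let g := classSum q (oddClasses C q A) ∘ₗ (kerOn C A).subtype
  have hinj : Function.Injective g := by
    rw [injective_iff_map_eq_zero]
    rintro ⟨w, hw⟩ h
    obtain ⟨hw1, hw2⟩ := (mem_kerOn_of_cliques hadj hloop).1 hw
    refine Subtype.ext (funext fun i => ?_)
    change w i = 0
    by_cases hA : i ∈ A
    swap
    · exact hw1 i hA
    by_cases hi : C i i = 0
    swap
    · exact (hw2 i hA).1 (zmod_two_eq_one hi)
    rw [(hw2 i hA).2 hi]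
    have hcl := class_loopless hloop hi
    by_cases hT : q i ∈ oddClasses C q A
    · exact congrFun h ⟨q i, hT⟩
    -- On its class, w is constant on A and zero off A, so the class sum is an even multiple of that
    -- constant.
    · have hev : Even (A.filter fun v => q v = q i).card := by
        by_contra ho
        exact hT (mem_oddClasses.2 ⟨hcl, Nat.not_even_iff_odd.1 ho⟩)
      rw [sum_class_eq_card_mul hw1 (a := ∑ j with q j = q i, w j) fun j hj hqj => by
        rw [(hw2 j hj).2 (hcl j hqj), hqj], ZMod.natCast_eq_zero_iff_even.2 hev, zero_mul]
  have hsurj : Function.Surjective g := by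
    intro f
    -- A vector equal to f c on A ∩ c has class sum |A ∩ c| · f c = f c, because |A ∩ c| is odd.
    let w : E → ZMod 2 := fun i =>
      if h : i ∈ A ∧ q i ∈ oddClasses C q A then f ⟨q i, h.2⟩ else 0
    have hw1 : ∀ i ∉ A, w i = 0 := fun i hi => dif_neg fun h => hi h.1
    have hsum : ∀ c : oddClasses C q A, ∑ j with q j = c, w j = f c := by
      intro c
      have hc := (mem_oddClasses.1 c.2).2
      rw [sum_class_eq_card_mul hw1 (a := f c), ZMod.natCast_eq_one_iff_odd.2 hc, one_mul]
      intro i hi hq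
      have : q i ∈ oddClasses C q A := hq ▸ c.2
      simp only [w, dif_pos (And.intro hi this)]
      congr 1
      exact Subtype.ext hq
    refine ⟨⟨w, (mem_kerOn_of_cliques hadj hloop).2 ⟨hw1, fun i hi => ⟨fun hl => ?_, fun hl => ?_⟩⟩⟩,
      funext hsum⟩
    · refine dif_neg fun h => ?_
      rw [(mem_oddClasses.1 h.2).1 i rfl] at hl
      exact zero_ne_one hl
    · by_cases hT : q i ∈ oddClasses C q A
      · rw [hsum ⟨q i, hT⟩]
        exact dif_pos ⟨hi, hT⟩
      · have h0 : ∀ j, q j = q i → w j = 0 := fun j hj => dif_neg fun h => hT (hj ▸ h.2)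
        rw [h0 i rfl, Finset.sum_eq_zero]
        intro j hj
        exact h0 j (Finset.mem_filter.1 hj).2
  simpa [nullity] using (LinearEquiv.ofBijective g ⟨hinj, hsurj⟩).finrank_eq

theorem nullity_split_of_cliques
    (hodd : ∀ c, (∀ v, q v = c → C v v = 0) → Odd (Finset.univ.filter fun v => q v = c).card)
    (A : Finset E) : nullity C A + nullity C Aᶜ = nullity C Finset.univ := by
  simp only [nullity_eq_card_oddClasses hadj hloop]
  have hcard : ∀ c, (A.filter fun v => q v = c).card + (Aᶜ.filter fun v => q v = c).card =
      (Finset.univ.filter fun v => q v = c).card := by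
    intro c
    rw [← Finset.card_union_of_disjoint
      (Finset.disjoint_filter_filter disjoint_compl_right), ← Finset.filter_union,
      Finset.union_compl]
  have hdisj : Disjoint (oddClasses C q A) (oddClasses C q Aᶜ) := by
    rw [Finset.disjoint_left]
    intro c h1 h2
    rw [mem_oddClasses] at h1 h2
    have h3 := hodd c h1.1
    rw [← hcard c] at h3
    exact Nat.not_even_iff_odd.2 h3 (h1.2.add_odd h2.2)
  rw [← Finset.card_union_of_disjoint hdisj]
  congr 1
  ext c
  rw [Finset.mem_union]
  simp only [mem_oddClasses]
  rw [← and_or_left]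
  refine and_congr_right fun hc => ?_
  have h3 := hodd c hc
  refine ⟨fun _ => h3, fun _ => ?_⟩
  rw [← hcard c, Nat.odd_add] at h3
  by_contra! h
  simp only [Nat.not_odd_iff_even] at h
  exact Nat.not_odd_iff_even.2 h.1 (h3.2 h.2)

end Cliques

/-! ### From components to splitting, and the main theorem -/

theorem nullity_split_of_components {C : Matrix E E (ZMod 2)} (hC : C.IsSymm)
    (h : ∀ c : (matrixGraph C hC).toSimpleGraph.ConnectedComponent,
      (matrixGraph C hC).IsOddCompleteOn c.supp ∨ (matrixGraph C hC).IsLoopedVertexOn c.supp)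
    (A : Finset E) : nullity C A + nullity C Aᶜ = nullity C Finset.univ := by
  classical
  have hloop : ∀ v, C v v = 1 → ∀ u, (matrixGraph C hC).toSimpleGraph.connectedComponentMk u =
      (matrixGraph C hC).toSimpleGraph.connectedComponentMk v → u = v := by
    intro v hv u huv
    rcases h ((matrixGraph C hC).toSimpleGraph.connectedComponentMk v) with hc | ⟨w, hw, -⟩
    · exact absurd rfl ((hc.2 v rfl v rfl).1 hv)
    · have h1 : u ∈ ({w} : Set E) := hw ▸ huv
      have h2 : v ∈ ({w} : Set E) := hw ▸ rfl
      exact h1.trans h2.symm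
  refine nullity_split_of_cliques
    (q := (matrixGraph C hC).toSimpleGraph.connectedComponentMk) ?_ hloop ?_ A
  · intro u v huv
    refine ⟨fun hadj => SimpleGraph.ConnectedComponent.sound
      (SimpleGraph.Adj.reachable ⟨huv, hadj⟩), fun hq => ?_⟩
    rcases h ((matrixGraph C hC).toSimpleGraph.connectedComponentMk v) with hc | ⟨w, hw, -⟩
    · exact (hc.2 u hq v rfl).2 huv
    · have h1 : u ∈ ({w} : Set E) := hw ▸ hq
      have h2 : v ∈ ({w} : Set E) := hw ▸ rfl
      exact absurd (h1.trans h2.symm) huv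
  · intro c hc
    rcases h c with ho | ⟨w, hw, hl⟩
    · have hset : c.supp = ((Finset.univ.filter fun v =>
          (matrixGraph C hC).toSimpleGraph.connectedComponentMk v = c : Finset E) : Set E) := by
        ext v; simp
      have := ho.1
      rwa [hset, Set.ncard_coe_finset] at this
    · have hwc : w ∈ c.supp := by rw [hw]; rfl
      have hl : C w w = 1 := hl
      rw [hc w hwc] at hl
      exact absurd hl zero_ne_one

end SetSystem

open SetSystem in
theorem mainTheorem1 {E : Type*} [Fintype E] [DecidableEq E] (D : SetSystem E)
    (hD : D.IsDeltaMatroid) (hnormal : D.IsNormal) (hbinary : D.IsBinary) :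
    (∃ (m : ℤ) (k : ℕ), D.twistPolynomial = Polynomial.C m * Polynomial.X ^ k) ↔
      ∀ c : D.intersectionGraph.toSimpleGraph.ConnectedComponent,
        D.intersectionGraph.IsOddCompleteOn c.supp ∨
          D.intersectionGraph.IsLoopedVertexOn c.supp := by
  obtain ⟨C, hC, rfl⟩ := exists_eq_ofMatrix hnormal hbinary
  have hG : (ofMatrix C).intersectionGraph = matrixGraph C hC := by
    simp only [intersectionGraph, matrixGraph, intersectionMatrix_ofMatrix C hC]
  rw [hG, twistPolynomial_monomial_iff hC]
  exact ⟨components_of_nullity_split hC, nullity_split_of_components hC⟩
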